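/- Let $\mathcal{E}$ be an exact category in the sense of Quillen, i.e. an additive category with a class of kernel-cokernel pairs (called conflations; their first maps are inflations, their second maps deflations) closed under isomorphisms, such that: every $X\to 0$ is a deflation, deflations are closed under composition, and pullbacks along deflations exist and preserve deflations; and dually, every $0\to X$ is an inflation, inflations are closed under composition, and pushouts along inflations exist and preserve inflations. A morphism is called admissible if it is the composite of a deflation followed by an inflation. Let $\mathcal{A}\subseteq\mathcal{E}$ be a two-sided admissibly percolating subcategory, i.e. a full nonempty subcategory such that (1) for every conflation $X\to Y\to Z$ in $\mathcal{E}$ one has $Y\in\mathcal{A}$ if and only if $X,Z\in\mathcal{A}$, and (2) every morphism $X\to T$ and every morphism $T\to X$ with $T\in\mathcal{A}$ is admissible with image in $\mathcal{A}$. Let $\Sigma_{\mathcal{A}}$ be the class of admissible morphisms in $\mathcal{E}$ whose kernel and cokernel lie in $\mathcal{A}$, and let $Q\colon\mathcal{E}\to\mathcal{E}/\mathcal{A}:=\Sigma_{\mathcal{A}}^{-1}\mathcal{E}$ be the localization functor. The conflations of $\mathcal{E}/\mathcal{A}$ are the sequences isomorphic in $\mathcal{E}/\mathcal{A}$ to the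 image under $Q$ of a conflation of $\mathcal{E}$, and inflations, deflations and admissible morphisms in $\mathcal{E}/\mathcal{A}$ are defined with respect to these. **Theorem.** A morphism $f\colon X\to Y$ in $\mathcal{E}$ is admissible in $\mathcal{E}$ if and only if $Q(f)$ is admissible in $\mathcal{E}/\mathcal{A}$. -/

import Mathlib

open CategoryTheory CategoryTheory.Limits

universe v v' u u'

namespace PercolatingQuotient

/-- A class of composable pairs `X ⟶ Y ⟶ Z` in a category, thought of as the class of chosen
conflations. -/
structure SequenceClass (C : Type u) [Category.{v} C] where
  /-- `Conflation f g` means that the sequence `f, g` belongs to the class. -/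
  Conflation : ∀ {X Y Z : C}, (X ⟶ Y) → (Y ⟶ Z) → Prop

namespace SequenceClass

variable {C : Type u} [Category.{v} C] (K : SequenceClass C)

/-- An inflation is the first map of a conflation. -/
def Inflation {X Y : C} (i : X ⟶ Y) : Prop :=
  ∃ (Z : C) (p : Y ⟶ Z), K.Conflation i p

/-- A deflation is the second map of a conflation. -/
def Deflation {Y Z : C} (p : Y ⟶ Z) : Prop :=
  ∃ (X : C) (i : X ⟶ Y), K.Conflation i p

/-- A morphism is admissible if it is a deflation followed by an inflation. -/
def Admissible {X Y : C} (f : X ⟶ Y) : Prop :=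
  ∃ (I : C) (p : X ⟶ I) (i : I ⟶ Y), K.Deflation p ∧ K.Inflation i ∧ p ≫ i = f

/-- The class of sequences in `D` which are isomorphic to the image under `F` of a
conflation in `C`. -/
def image {D : Type u'} [Category.{v'} D] (F : C ⥤ D) : SequenceClass D where
  Conflation {X Y Z} f g :=
    ∃ (X' Y' Z' : C) (f' : X' ⟶ Y') (g' : Y' ⟶ Z')
      (a : F.obj X' ≅ X) (b : F.obj Y' ≅ Y) (c : F.obj Z' ≅ Z),
      K.Conflation f' g' ∧ F.map f' ≫ b.hom = a.hom ≫ f ∧ F.map g' ≫ c.hom = b.hom ≫ g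

/-- `(C, K)` is a conflation category: `K` is a class of kernel-cokernel pairs, closed under
isomorphisms. -/
structure IsConflationStructure [Preadditive C] : Prop where
  kernel_cokernel {X Y Z : C} {f : X ⟶ Y} {g : Y ⟶ Z} (h : K.Conflation f g) :
    ∃ w : f ≫ g = 0, Nonempty (IsLimit (KernelFork.ofι f w)) ∧
      Nonempty (IsColimit (CokernelCofork.ofπ g w))
  of_iso {X Y Z X' Y' Z' : C} {f : X ⟶ Y} {g : Y ⟶ Z} {f' : X' ⟶ Y'} {g' : Y' ⟶ Z'}
    (a : X ≅ X') (b : Y ≅ Y') (c : Z ≅ Z')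
    (hf : f ≫ b.hom = a.hom ≫ f') (hg : g ≫ c.hom = b.hom ≫ g')
    (h : K.Conflation f g) : K.Conflation f' g'

/-- `(C, K)` is an exact category in the sense of Quillen (the underlying category being
additive). -/
structure IsExactStructure [Preadditive C] [HasFiniteBiproducts C] : Prop
    extends K.IsConflationStructure where
  deflation_to_zero (X Z : C) (hZ : IsZero Z) : K.Deflation (0 : X ⟶ Z)
  deflation_comp {X Y Z : C} {p : X ⟶ Y} {q : Y ⟶ Z} :
    K.Deflation p → K.Deflation q → K.Deflation (p ≫ q)
  hasPullback {X Y Z : C} (p : X ⟶ Z) (g : Y ⟶ Z) : K.Deflation p → HasPullback p g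
  deflation_of_isPullback {P X Y Z : C} {fst : P ⟶ X} {snd : P ⟶ Y} {p : X ⟶ Z} {g : Y ⟶ Z} :
    IsPullback fst snd p g → K.Deflation p → K.Deflation snd
  inflation_from_zero (Z X : C) (hZ : IsZero Z) : K.Inflation (0 : Z ⟶ X)
  inflation_comp {X Y Z : C} {i : X ⟶ Y} {j : Y ⟶ Z} :
    K.Inflation i → K.Inflation j → K.Inflation (i ≫ j)
  hasPushout {X Y Z : C} (i : Z ⟶ X) (g : Z ⟶ Y) : K.Inflation i → HasPushout i g
  inflation_of_isPushout {P X Y Z : C} {i : Z ⟶ X} {g : Z ⟶ Y} {inl : X ⟶ P} {inr : Y ⟶ P} :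
    IsPushout i g inl inr → K.Inflation i → K.Inflation inr

/-- The full subcategory `A` is nonempty and a Serre subcategory. -/
structure IsSerreSubcategory (A : ObjectProperty C) : Prop where
  nonempty : ∃ X, A X
  serre {X Y Z : C} {f : X ⟶ Y} {g : Y ⟶ Z} : K.Conflation f g → (A Y ↔ A X ∧ A Z)

/-- Admissibly deflation-percolating subcategories: Serre subcategories `A` such that every
morphism to an object of `A` is admissible with image in `A`. -/
structure IsDeflationPercolating (A : ObjectProperty C) : Prop
    extends K.IsSerreSubcategory A where
  admissible_to {X T : C} (f : X ⟶ T) : A T →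
    ∃ (I : C) (p : X ⟶ I) (i : I ⟶ T), K.Deflation p ∧ K.Inflation i ∧ p ≫ i = f ∧ A I

/-- Admissibly inflation-percolating subcategories: Serre subcategories `A` such that every
morphism from an object of `A` is admissible with image in `A`. -/
structure IsInflationPercolating (A : ObjectProperty C) : Prop
    extends K.IsSerreSubcategory A where
  admissible_from {T X : C} (f : T ⟶ X) : A T →
    ∃ (I : C) (p : T ⟶ I) (i : I ⟶ X), K.Deflation p ∧ K.Inflation i ∧ p ≫ i = f ∧ A I

/-- Two-sided admissibly percolating subcategories. -/
structure IsTwoSidedPercolating (A : ObjectProperty C) : Prop where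
  deflationPercolating : K.IsDeflationPercolating A
  inflationPercolating : K.IsInflationPercolating A

/-- The weak `A`-isomorphisms: admissible morphisms with kernel and cokernel in `A`. -/
def weakIsomorphisms [Preadditive C] (A : ObjectProperty C) : MorphismProperty C :=
  fun X Y f => K.Admissible f ∧
    (∃ (N : C) (k : N ⟶ X) (w : k ≫ f = 0), Nonempty (IsLimit (KernelFork.ofι k w)) ∧ A N) ∧
    (∃ (N : C) (c : Y ⟶ N) (w : f ≫ c = 0), Nonempty (IsColimit (CokernelCofork.ofπ c w)) ∧ A N)

end SequenceClass

end PercolatingQuotient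

/-!
Since `A` is percolating, an inflation with cokernel in `A` followed by a deflation is again
admissible. This shows that the weak isomorphisms compose and admit a calculus of fractions on both
sides, and that admissibility of a morphism is not affected by composing it with a weak isomorphism
on either side. Conversely, a weak isomorphism can be cancelled on either side of an admissible
morphism.

The weak isomorphisms are moreover saturated: if `b` becomes invertible in the quotient, then
`u ≫ b` and `b ≫ v` are weak isomorphisms for some `u` and `v`. The second one provides a kernel of
`b`, which allows one to assume that `b` is a monomorphism, and then the first one exhibits the
restriction of `b` to a subobject with quotient in `A` as an inflation. Hence isomorphisms of
the quotient are roofs of weak isomorphisms.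

If `Q f` is admissible, it is up to isomorphism the image of a deflation, a roof of weak
isomorphisms and the image of an inflation. Pulling the deflation back along the left leg of the
roof, `Q f` becomes isomorphic to `Q g` for an admissible `g`. The isomorphisms of the ends are
again roofs, so `f` is obtained from `g` by composing with and cancelling weak isomorphisms.
-/

namespace PercolatingQuotient

/-! ### Conflations -/

section Pullback

variable {C : Type u} [Category.{v} C]

lemma isPullback_of_exists_lift {P X Y Z : C} {fst : P ⟶ X} {snd : P ⟶ Y} {f : X ⟶ Z} {g : Y ⟶ Z}
    (w : fst ≫ f = snd ≫ g)
    (hom_ext : ∀ {T : C} (a b : T ⟶ P), a ≫ fst = b ≫ fst → a ≫ snd = b ≫ snd → a = b)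
    (exists_lift : ∀ {T : C} (a : T ⟶ X) (b : T ⟶ Y), a ≫ f = b ≫ g →
      ∃ l : T ⟶ P, l ≫ fst = a ∧ l ≫ snd = b) : IsPullback fst snd f g := by
  choose l hl₁ hl₂ using fun s : PullbackCone f g => exists_lift s.fst s.snd s.condition
  exact ⟨⟨w⟩, ⟨PullbackCone.IsLimit.mk w l hl₁ hl₂ fun s m h₁ h₂ =>
    hom_ext m (l s) (h₁.trans (hl₁ s).symm) (h₂.trans (hl₂ s).symm)⟩⟩

end Pullback

namespace SequenceClass

section Basic

variable {C : Type u} [Category.{v} C] {K : SequenceClass C}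

lemma Conflation.inflation {X Y Z : C} {f : X ⟶ Y} {g : Y ⟶ Z} (h : K.Conflation f g) :
    K.Inflation f :=
  ⟨Z, g, h⟩

lemma Conflation.deflation {X Y Z : C} {f : X ⟶ Y} {g : Y ⟶ Z} (h : K.Conflation f g) :
    K.Deflation g :=
  ⟨X, f, h⟩

/-- The opposite of a class of sequences: reversing a conflation `X ⟶ Y ⟶ Z` gives a conflation in
the opposite category. It is used to dualize statements about `K`. -/
def op (K : SequenceClass C) : SequenceClass Cᵒᵖ where
  Conflation f g := K.Conflation g.unop f.unop

lemma op_deflation_iff {X Y : Cᵒᵖ} {f : X ⟶ Y} : K.op.Deflation f ↔ K.Inflation f.unop :=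
  ⟨fun ⟨Z, g, h⟩ => ⟨Z.unop, g.unop, h⟩, fun ⟨Z, g, h⟩ => ⟨.op Z, g.op, h⟩⟩

lemma op_inflation_iff {X Y : Cᵒᵖ} {f : X ⟶ Y} : K.op.Inflation f ↔ K.Deflation f.unop :=
  ⟨fun ⟨Z, g, h⟩ => ⟨Z.unop, g.unop, h⟩, fun ⟨Z, g, h⟩ => ⟨.op Z, g.op, h⟩⟩

lemma op_admissible_iff {X Y : Cᵒᵖ} {f : X ⟶ Y} : K.op.Admissible f ↔ K.Admissible f.unop :=
  ⟨fun ⟨I, p, i, hp, hi, h⟩ => ⟨I.unop, i.unop, p.unop, op_inflation_iff.1 hi,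
      op_deflation_iff.1 hp, congr_arg Quiver.Hom.unop h⟩,
    fun ⟨I, p, i, hp, hi, h⟩ => ⟨.op I, i.op, p.op, op_deflation_iff.2 hi,
      op_inflation_iff.2 hp, Quiver.Hom.unop_inj h⟩⟩

/-- A factorization of `f` as a deflation `p` followed by an inflation `i`, with chosen conflations
starting with a kernel `k` of `p` and ending with a cokernel `c` of `i`. When conflations are
kernel-cokernel pairs, `k` and `c` are also a kernel and a cokernel of `f`. -/
structure AdmissibleFactorization (K : SequenceClass C) {X Y : C} (f : X ⟶ Y) where
  {ker im coker : C}
  k : ker ⟶ X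
  p : X ⟶ im
  i : im ⟶ Y
  c : Y ⟶ coker
  conflation_ker : K.Conflation k p
  conflation_coker : K.Conflation i c
  fac : p ≫ i = f

namespace AdmissibleFactorization

variable {X Y : C} {f : X ⟶ Y}

lemma admissible (φ : K.AdmissibleFactorization f) : K.Admissible f :=
  ⟨φ.im, φ.p, φ.i, φ.conflation_ker.deflation, φ.conflation_coker.inflation, φ.fac⟩

/-- The opposite factorization of `f.op`; it exchanges kernels and cokernels. -/
def op (φ : K.AdmissibleFactorization f) : K.op.AdmissibleFactorization f.op where
  k := φ.c.op
  p := φ.i.op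
  i := φ.p.op
  c := φ.k.op
  conflation_ker := φ.conflation_coker
  conflation_coker := φ.conflation_ker
  fac := congr_arg Quiver.Hom.op φ.fac

/-- The factorization of `f.unop` underlying a factorization in the opposite category; it exchanges
kernels and cokernels. -/
def unop {X Y : Cᵒᵖ} {f : X ⟶ Y} (φ : K.op.AdmissibleFactorization f) :
    K.AdmissibleFactorization f.unop where
  k := φ.c.unop
  p := φ.i.unop
  i := φ.p.unop
  c := φ.k.unop
  conflation_ker := φ.conflation_coker
  conflation_coker := φ.conflation_ker
  fac := congr_arg Quiver.Hom.unop φ.fac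

end AdmissibleFactorization

lemma Admissible.nonempty_factorization {X Y : C} {f : X ⟶ Y} (hf : K.Admissible f) :
    Nonempty (K.AdmissibleFactorization f) := by
  obtain ⟨I, p, i, ⟨N, k, hk⟩, ⟨L, c, hc⟩, hpi⟩ := hf
  exact ⟨⟨k, p, i, c, hk, hc, hpi⟩⟩

end Basic

section Conflation

variable {C : Type u} [Category.{v} C] [Preadditive C] {K : SequenceClass C}

namespace IsConflationStructure

variable (hK : K.IsConflationStructure)
include hK

lemma comp_eq_zero {X Y Z : C} {f : X ⟶ Y} {g : Y ⟶ Z} (h : K.Conflation f g) : f ≫ g = 0 :=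
  (hK.kernel_cokernel h).choose

lemma mono {X Y Z : C} {f : X ⟶ Y} {g : Y ⟶ Z} (h : K.Conflation f g) : Mono f := by
  obtain ⟨w, ⟨hf⟩, -⟩ := hK.kernel_cokernel h
  exact mono_of_isLimit_fork hf

lemma epi {X Y Z : C} {f : X ⟶ Y} {g : Y ⟶ Z} (h : K.Conflation f g) : Epi g := by
  obtain ⟨w, -, ⟨hg⟩⟩ := hK.kernel_cokernel h
  exact epi_of_isColimit_cofork hg

lemma exists_lift {X Y Z T : C} {f : X ⟶ Y} {g : Y ⟶ Z} (h : K.Conflation f g)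
    (t : T ⟶ Y) (ht : t ≫ g = 0) : ∃ l : T ⟶ X, l ≫ f = t := by
  obtain ⟨w, ⟨hf⟩, -⟩ := hK.kernel_cokernel h
  exact ⟨_, (KernelFork.IsLimit.lift' hf t ht).2⟩

lemma exists_desc {X Y Z T : C} {f : X ⟶ Y} {g : Y ⟶ Z} (h : K.Conflation f g)
    (t : Y ⟶ T) (ht : f ≫ t = 0) : ∃ l : Z ⟶ T, g ≫ l = t := by
  obtain ⟨w, -, ⟨hg⟩⟩ := hK.kernel_cokernel h
  exact ⟨_, (CokernelCofork.IsColimit.desc' hg t ht).2⟩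

lemma op : K.op.IsConflationStructure where
  kernel_cokernel {X Y Z f g} h := by
    obtain ⟨w, ⟨hf⟩, ⟨hg⟩⟩ := hK.kernel_cokernel (K := K) h
    exact ⟨Quiver.Hom.unop_inj w, ⟨CokernelCofork.IsColimit.ofπOp _ _ hg⟩,
      ⟨KernelFork.IsLimit.ofιOp _ _ hf⟩⟩
  of_iso a b c hf hg h :=
    have hg' : b.inv ≫ _ = _ ≫ c.inv := by
      rw [Iso.inv_comp_eq, ← Category.assoc, ← hg, Category.assoc, Iso.hom_inv_id, Category.comp_id]
    have hf' : a.inv ≫ _ = _ ≫ b.inv := by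
      rw [Iso.inv_comp_eq, ← Category.assoc, ← hf, Category.assoc, Iso.hom_inv_id, Category.comp_id]
    hK.of_iso c.unop.symm b.unop.symm a.unop.symm
      (congr_arg Quiver.Hom.unop hg') (congr_arg Quiver.Hom.unop hf') h

lemma strongEpi {X Y Z : C} {f : X ⟶ Y} {g : Y ⟶ Z} (h : K.Conflation f g) : StrongEpi g := by
  obtain ⟨w, -, ⟨hg⟩⟩ := hK.kernel_cokernel h
  have : IsRegularEpi g := ⟨⟨Cofork.IsColimit.regularEpi hg⟩⟩
  infer_instance

lemma isIso_right_of_mono {X Y Z : C} {f : X ⟶ Y} {g : Y ⟶ Z} (h : K.Conflation f g) [Mono g] :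
    IsIso g :=
  have := hK.strongEpi h
  isIso_of_mono_of_strongEpi g

lemma isIso_left_of_epi {X Y Z : C} {f : X ⟶ Y} {g : Y ⟶ Z} (h : K.Conflation f g) [Epi f] :
    IsIso f :=
  (isIso_op_iff f).1 (hK.op.isIso_right_of_mono (f := g.op) (g := f.op) h)

lemma conflation_of_exists_lift {X Y Z : C} {f : X ⟶ Y} {g : Y ⟶ Z} (hg : K.Deflation g) [Mono f]
    (w : f ≫ g = 0) (exists_lift : ∀ {T : C} (t : T ⟶ Y), t ≫ g = 0 → ∃ l : T ⟶ X, l ≫ f = t) :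
    K.Conflation f g := by
  obtain ⟨X', f', h⟩ := hg
  have := hK.mono h
  obtain ⟨a, ha⟩ := hK.exists_lift h f w
  obtain ⟨b, hb⟩ := exists_lift f' (hK.comp_eq_zero h)
  have hba : b ≫ a = 𝟙 X' := by simp [← cancel_mono f', ha, hb]
  have hab : a ≫ b = 𝟙 X := by simp [← cancel_mono f, ha, hb]
  exact hK.of_iso ⟨b, a, hba, hab⟩ (Iso.refl Y) (Iso.refl Z) (by simp [hb]) (by simp) h

lemma exists_conflation_of_isPullback {P X Y Z N : C} {fst : P ⟶ X} {snd : P ⟶ Y} {p : X ⟶ Z}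
    {g : Y ⟶ Z} (hP : IsPullback fst snd p g) (hsnd : K.Deflation snd) {k : N ⟶ X}
    (hk : K.Conflation k p) : ∃ k' : N ⟶ P, k' ≫ fst = k ∧ K.Conflation k' snd := by
  obtain ⟨k', hk', hk'_snd⟩ := hP.exists_lift k 0 (by simp [hK.comp_eq_zero hk])
  have := hK.mono hk
  have : Mono k' := mono_of_mono_fac hk'
  refine ⟨k', hk', hK.conflation_of_exists_lift hsnd hk'_snd fun t ht => ?_⟩
  obtain ⟨l, hl⟩ := hK.exists_lift hk (t ≫ fst)
    (by rw [Category.assoc, hP.w, reassoc_of% ht, zero_comp])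
  exact ⟨l, hP.hom_ext (by simp [hk', hl]) (by simp [hk'_snd, ht])⟩

lemma exists_isPullback_of_conflation_comp {X Y Z L M : C} {p : X ⟶ Y} {l : L ⟶ Y} {q : Y ⟶ Z}
    {m : M ⟶ X} (hq : K.Conflation l q) (hm : K.Conflation m (p ≫ q)) :
    ∃ r : M ⟶ L, IsPullback m r p l := by
  have := hK.mono hq
  have := hK.mono hm
  obtain ⟨r, hr⟩ := hK.exists_lift hq (m ≫ p) (by rw [Category.assoc, hK.comp_eq_zero hm])
  refine ⟨r, isPullback_of_exists_lift hr.symm (fun a b h _ => (cancel_mono m).1 h)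
    fun a b hab => ?_⟩
  obtain ⟨t, rfl⟩ := hK.exists_lift hm a (by rw [reassoc_of% hab, hK.comp_eq_zero hq, comp_zero])
  exact ⟨t, rfl, by rw [← cancel_mono l, Category.assoc, hr, ← hab, Category.assoc]⟩

lemma isIso_comp_of_retraction {X N Y I : C} {x : X ⟶ Y} {r : Y ⟶ N} {n : N ⟶ Y} {π : Y ⟶ I}
    (hx : K.Conflation x r) (hn : K.Conflation n π) (hnr : n ≫ r = 𝟙 N) : IsIso (x ≫ π) := by
  have := hK.mono hx
  have := hK.epi hn
  obtain ⟨δ, hδ⟩ := hK.exists_desc hn (𝟙 Y - r ≫ n) (by simp [reassoc_of% hnr])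
  have hδr : δ ≫ r = 0 := by rw [← cancel_epi π, reassoc_of% hδ]; simp [hnr]
  obtain ⟨l, rfl⟩ := hK.exists_lift hx δ hδr
  refine ⟨l, ?_, ?_⟩
  · rw [← cancel_mono x, Category.assoc, Category.assoc, hδ]
    simp [reassoc_of% hK.comp_eq_zero hx]
  · rw [← cancel_epi π, reassoc_of% hδ]
    simp [hK.comp_eq_zero hn]

section Factorization

variable {X Y : C} {f : X ⟶ Y} (φ : K.AdmissibleFactorization f)

lemma ker_comp : φ.k ≫ f = 0 :=
  calc φ.k ≫ f = φ.k ≫ φ.p ≫ φ.i := by rw [φ.fac]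
    _ = 0 := by rw [reassoc_of% hK.comp_eq_zero φ.conflation_ker, zero_comp]

lemma comp_coker : f ≫ φ.c = 0 :=
  calc f ≫ φ.c = (φ.p ≫ φ.i) ≫ φ.c := by rw [φ.fac]
    _ = 0 := by rw [Category.assoc, hK.comp_eq_zero φ.conflation_coker, comp_zero]

lemma nonempty_isLimit_ker : Nonempty (IsLimit (KernelFork.ofι φ.k (hK.ker_comp φ))) := by
  obtain ⟨w, ⟨hk⟩, -⟩ := hK.kernel_cokernel φ.conflation_ker
  have := hK.mono φ.conflation_coker
  exact ⟨isKernelCompMono hk φ.i φ.fac.symm⟩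

lemma nonempty_isColimit_coker :
    Nonempty (IsColimit (CokernelCofork.ofπ φ.c (hK.comp_coker φ))) := by
  obtain ⟨w, -, ⟨hc⟩⟩ := hK.kernel_cokernel φ.conflation_coker
  have := hK.epi φ.conflation_ker
  exact ⟨isCokernelEpiComp hc φ.p φ.fac.symm⟩

lemma exists_lift_ker {T : C} (t : T ⟶ X) (ht : t ≫ f = 0) : ∃ l : T ⟶ φ.ker, l ≫ φ.k = t :=
  ⟨_, (KernelFork.IsLimit.lift' (hK.nonempty_isLimit_ker φ).some t ht).2⟩

end Factorization

end IsConflationStructure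

end Conflation

section Exact

variable {C : Type u} [Category.{v} C] [Preadditive C] [HasFiniteBiproducts C]
  {K : SequenceClass C}

instance hasFiniteBiproducts_op : HasFiniteBiproducts Cᵒᵖ :=
  HasFiniteBiproducts.of_hasFiniteProducts

namespace IsExactStructure

variable (hK : K.IsExactStructure)
include hK

lemma op : K.op.IsExactStructure where
  toIsConflationStructure := hK.toIsConflationStructure.op
  deflation_to_zero X Z hZ := op_deflation_iff.2 (hK.inflation_from_zero _ _ hZ.unop)
  deflation_comp hp hq := op_deflation_iff.2
    (hK.inflation_comp (op_deflation_iff.1 hq) (op_deflation_iff.1 hp))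
  hasPullback p g hp := by
    have := hK.hasPushout p.unop g.unop (op_deflation_iff.1 hp)
    exact (IsPushout.of_hasPushout p.unop g.unop).op.flip.hasPullback
  deflation_of_isPullback h hp := op_deflation_iff.2
    (hK.inflation_of_isPushout h.unop.flip (op_deflation_iff.1 hp))
  inflation_from_zero Z X hZ := op_inflation_iff.2 (hK.deflation_to_zero _ _ hZ.unop)
  inflation_comp hi hj := op_inflation_iff.2
    (hK.deflation_comp (op_inflation_iff.1 hj) (op_inflation_iff.1 hi))
  hasPushout i g hi := by
    have := hK.hasPullback i.unop g.unop (op_inflation_iff.1 hi)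
    exact (IsPullback.of_hasPullback i.unop g.unop).op.flip.hasPushout
  inflation_of_isPushout h hi := op_inflation_iff.2
    (hK.deflation_of_isPullback h.unop.flip (op_inflation_iff.1 hi))

lemma conflation_isIso_zero {X Y Z : C} (e : X ⟶ Y) [IsIso e] (hZ : IsZero Z) :
    K.Conflation e (0 : Y ⟶ Z) :=
  hK.conflation_of_exists_lift (hK.deflation_to_zero Y Z hZ) comp_zero
    fun t _ => ⟨t ≫ inv e, by simp⟩

lemma conflation_zero_isIso {X Y Z : C} (e : X ⟶ Y) [IsIso e] (hZ : IsZero Z) :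
    K.Conflation (0 : Z ⟶ X) e :=
  hK.op.conflation_isIso_zero e.op hZ.op

lemma inflation_of_isIso {X Y : C} (e : X ⟶ Y) [IsIso e] : K.Inflation e :=
  have := hasZeroObject_of_hasFiniteBiproducts C
  (hK.conflation_isIso_zero e (isZero_zero C)).inflation

lemma deflation_of_isIso {X Y : C} (e : X ⟶ Y) [IsIso e] : K.Deflation e :=
  have := hasZeroObject_of_hasFiniteBiproducts C
  (hK.conflation_zero_isIso e (isZero_zero C)).deflation

lemma admissible_of_inflation {X Y : C} {i : X ⟶ Y} (hi : K.Inflation i) : K.Admissible i :=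
  ⟨X, 𝟙 X, i, hK.deflation_of_isIso (𝟙 X), hi, Category.id_comp i⟩

lemma admissible_deflation_comp {X Y Z : C} {p : X ⟶ Y} {f : Y ⟶ Z} (hp : K.Deflation p)
    (hf : K.Admissible f) : K.Admissible (p ≫ f) := by
  obtain ⟨I, q, i, hq, hi, rfl⟩ := hf
  exact ⟨I, p ≫ q, i, hK.deflation_comp hp hq, hi, Category.assoc p q i⟩

lemma exists_baseChange {N X Y Z : C} {k : N ⟶ X} {p : X ⟶ Z} (h : K.Conflation k p)
    (g : Y ⟶ Z) : ∃ (P : C) (fst : P ⟶ X) (snd : P ⟶ Y) (k' : N ⟶ P),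
      IsPullback fst snd p g ∧ K.Conflation k' snd := by
  have := hK.hasPullback p g h.deflation
  have hP := IsPullback.of_hasPullback p g
  obtain ⟨k', -, hk'⟩ :=
    hK.exists_conflation_of_isPullback hP (hK.deflation_of_isPullback hP h.deflation) h
  exact ⟨_, _, _, k', hP, hk'⟩

lemma exists_conflation_ker_comp {N X Y Z L M : C} {k : N ⟶ X} {p : X ⟶ Y} {l : L ⟶ Y}
    {q : Y ⟶ Z} {m : M ⟶ X} (hk : K.Conflation k p) (hl : K.Conflation l q)
    (hm : K.Conflation m (p ≫ q)) :
    ∃ (k' : N ⟶ M) (r : M ⟶ L), k' ≫ m = k ∧ m ≫ p = r ≫ l ∧ K.Conflation k' r := by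
  obtain ⟨r, hP⟩ := hK.exists_isPullback_of_conflation_comp hl hm
  obtain ⟨k', hk'm, hk'⟩ :=
    hK.exists_conflation_of_isPullback hP (hK.deflation_of_isPullback hP hk.deflation) hk
  exact ⟨k', r, hk'm, hP.w, hk'⟩

lemma exists_conflation_coker_comp {X Y Z M N L : C} {i : X ⟶ Y} {c : Y ⟶ M} {j : Y ⟶ Z}
    {d : Z ⟶ N} {m : Z ⟶ L} (hc : K.Conflation i c) (hd : K.Conflation j d)
    (hm : K.Conflation (i ≫ j) m) :
    ∃ (l : M ⟶ L) (r : L ⟶ N), j ≫ m = c ≫ l ∧ m ≫ r = d ∧ K.Conflation l r := by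
  obtain ⟨r, l, hmr, hjm, h⟩ :=
    hK.op.exists_conflation_ker_comp (k := d.op) (p := j.op) (l := c.op) (q := i.op) (m := m.op)
      hd hc hm
  exact ⟨l.unop, r.unop, Quiver.Hom.op_inj hjm, Quiver.Hom.op_inj hmr, h⟩

lemma exists_factorization_comp {X Y Z : C} {s : X ⟶ Y} {t : Y ⟶ Z}
    (φ : K.AdmissibleFactorization s) (ψ : K.AdmissibleFactorization t)
    (χ : K.AdmissibleFactorization (φ.i ≫ ψ.p)) :
    ∃ ω : K.AdmissibleFactorization (s ≫ t),
      (∃ (a : φ.ker ⟶ ω.ker) (b : ω.ker ⟶ χ.ker), K.Conflation a b) ∧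
      (∃ (a : χ.coker ⟶ ω.coker) (b : ω.coker ⟶ ψ.coker), K.Conflation a b) := by
  obtain ⟨M, m, hm⟩ := hK.deflation_comp φ.conflation_ker.deflation χ.conflation_ker.deflation
  obtain ⟨L, d, hd⟩ :=
    hK.inflation_comp χ.conflation_coker.inflation ψ.conflation_coker.inflation
  have fac : (φ.p ≫ χ.p) ≫ χ.i ≫ ψ.i = s ≫ t := by
    rw [Category.assoc, reassoc_of% χ.fac, ψ.fac, reassoc_of% φ.fac]
  obtain ⟨a, b, -, -, hab⟩ := hK.exists_conflation_ker_comp φ.conflation_ker χ.conflation_ker hm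
  obtain ⟨a', b', -, -, hab'⟩ :=
    hK.exists_conflation_coker_comp χ.conflation_coker ψ.conflation_coker hd
  exact ⟨⟨m, _, _, d, hm, hd, fac⟩, ⟨a, b, hab⟩, ⟨a', b', hab'⟩⟩

lemma isPullback_of_conflations {W X Z Y B : C} {w : W ⟶ X} {x : X ⟶ Z} {w' : W ⟶ Y} {y : Y ⟶ B}
    (h : K.Conflation w x) (h' : K.Conflation w' y) {φ : X ⟶ Y} {β : Z ⟶ B}
    (hw : w ≫ φ = w') (hφ : φ ≫ y = x ≫ β) : IsPullback x φ β y := by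
  have := hK.mono h'
  have eq_zero {T : C} (t : T ⟶ X) (htx : t ≫ x = 0) (htφ : t ≫ φ = 0) : t = 0 := by
    obtain ⟨l, rfl⟩ := hK.exists_lift h t htx
    rw [Category.assoc, hw] at htφ
    rw [zero_of_comp_mono w' htφ, zero_comp]
  refine isPullback_of_exists_lift hφ.symm (fun a b hx hy => ?_) fun {T} c b hcb => ?_
  · exact sub_eq_zero.1 (eq_zero (a - b) (by simp [hx]) (by simp [hy]))
  -- Lift `c` to `X` after base change along `x`, correct by an element of `W`, and descend.
  obtain ⟨P, a, t, n, hP, hn⟩ := hK.exists_baseChange h c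
  obtain ⟨l, hl⟩ := hK.exists_lift h' (t ≫ b - a ≫ φ) (by simp [← hcb, hφ, reassoc_of% hP.w])
  have lift_x : (a + l ≫ w) ≫ x = t ≫ c := by simp [hK.comp_eq_zero h, hP.w]
  have lift_φ : (a + l ≫ w) ≫ φ = t ≫ b := by simp [hw, hl]
  have hnt := hK.comp_eq_zero hn
  obtain ⟨e, he⟩ := hK.exists_desc hn (a + l ≫ w) (eq_zero _
    (by rw [Category.assoc, lift_x, reassoc_of% hnt, zero_comp])
    (by rw [Category.assoc, lift_φ, reassoc_of% hnt, zero_comp]))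
  have := hK.epi hn
  exact ⟨e, by rw [← cancel_epi t, reassoc_of% he, lift_x],
    by rw [← cancel_epi t, reassoc_of% he, lift_φ]⟩

lemma conflation_comp_of_conflation_comp {X Y Z N L L' : C} {i : X ⟶ Y} {c : Y ⟶ L} {n : N ⟶ Y}
    {p : Y ⟶ Z} {c' : L ⟶ L'} {z : Z ⟶ L'} (hi : K.Conflation i c) (hp : K.Conflation n p)
    (hc' : K.Conflation (n ≫ c) c') (hz : K.Deflation z) (w : p ≫ z = c ≫ c') :
    K.Conflation (i ≫ p) z := by
  obtain ⟨I, κ, hκ⟩ := hz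
  obtain ⟨M, m, hm⟩ := hK.deflation_comp hi.deflation hc'.deflation
  obtain ⟨x, r, hxm, hmc, hx⟩ := hK.exists_conflation_ker_comp hi hc' hm
  obtain ⟨n', π, hn'm, hmp, hn'⟩ := hK.exists_conflation_ker_comp hp hκ (w ▸ hm)
  have := hK.mono hc'
  have hn'r : n' ≫ r = 𝟙 N := by
    rw [← cancel_mono (n ≫ c), Category.assoc, ← hmc, reassoc_of% hn'm, Category.id_comp]
  have := hK.isIso_comp_of_retraction hx hn' hn'r
  have hxπ : (x ≫ π) ≫ κ = i ≫ p := by rw [Category.assoc, ← hmp, reassoc_of% hxm]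
  exact hK.of_iso (asIso (x ≫ π)).symm (Iso.refl Z) (Iso.refl L')
    (by simp [← hxπ]) (by simp) hκ

lemma mono_of_exists_lift {N X I Y : C} {k : N ⟶ X} {q : X ⟶ I} {μ : I ⟶ Y}
    (hq : K.Conflation k q)
    (exists_lift : ∀ {T : C} (t : T ⟶ X), t ≫ q ≫ μ = 0 → ∃ l : T ⟶ N, l ≫ k = t) : Mono μ := by
  refine Preadditive.mono_of_cancel_zero μ fun {T} t ht => ?_
  obtain ⟨P, fst, snd, k', hP, hk'⟩ := hK.exists_baseChange hq t
  have := hK.epi hk'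
  obtain ⟨l, rfl⟩ := exists_lift fst (by rw [reassoc_of% hP.w, ht, comp_zero])
  refine zero_of_epi_comp snd ?_
  rw [← hP.w, Category.assoc, hK.comp_eq_zero hq, comp_zero]

end IsExactStructure

end Exact

/-! ### Percolating subcategories -/

section Opposite

variable {C : Type u} [Category.{v} C] {K : SequenceClass C} {A : ObjectProperty C}

lemma IsSerreSubcategory.op (hA : K.IsSerreSubcategory A) : K.op.IsSerreSubcategory A.op where
  nonempty := ⟨.op hA.nonempty.choose, hA.nonempty.choose_spec⟩
  serre h := (hA.serre (K := K) h).trans and_comm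

lemma IsInflationPercolating.op (hA : K.IsInflationPercolating A) :
    K.op.IsDeflationPercolating A.op where
  toIsSerreSubcategory := hA.toIsSerreSubcategory.op
  admissible_to f hT := by
    obtain ⟨I, p, i, hp, hi, hpi, hI⟩ := hA.admissible_from f.unop hT
    exact ⟨.op I, i.op, p.op, op_deflation_iff.2 hi, op_inflation_iff.2 hp,
      Quiver.Hom.unop_inj hpi, hI⟩

lemma IsDeflationPercolating.op (hA : K.IsDeflationPercolating A) :
    K.op.IsInflationPercolating A.op where
  toIsSerreSubcategory := hA.toIsSerreSubcategory.op
  admissible_from f hT := by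
    obtain ⟨I, p, i, hp, hi, hpi, hI⟩ := hA.admissible_to f.unop hT
    exact ⟨.op I, i.op, p.op, op_deflation_iff.2 hi, op_inflation_iff.2 hp,
      Quiver.Hom.unop_inj hpi, hI⟩

lemma IsInflationPercolating.admissible_of_prop_source (hA : K.IsInflationPercolating A) {T X : C}
    (f : T ⟶ X) (hT : A T) : K.Admissible f := by
  obtain ⟨I, p, i, hp, hi, hpi, -⟩ := hA.admissible_from f hT
  exact ⟨I, p, i, hp, hi, hpi⟩

lemma IsDeflationPercolating.exists_factorization (hA : K.IsDeflationPercolating A) {X T : C}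
    (f : X ⟶ T) (hT : A T) : ∃ φ : K.AdmissibleFactorization f, A φ.im ∧ A φ.coker := by
  obtain ⟨I, p, i, ⟨N, k, hk⟩, ⟨L, c, hc⟩, hpi, hI⟩ := hA.admissible_to f hT
  exact ⟨⟨k, p, i, c, hk, hc, hpi⟩, hI, ((hA.serre hc).1 hT).2⟩

end Opposite

section Percolating

variable {C : Type u} [Category.{v} C] [Preadditive C] [HasFiniteBiproducts C]
  {K : SequenceClass C} {A : ObjectProperty C}

namespace IsSerreSubcategory

variable (hA : K.IsSerreSubcategory A) (hK : K.IsExactStructure)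
include hA hK

lemma prop_of_isZero {Z : C} (hZ : IsZero Z) : A Z := by
  obtain ⟨X, hX⟩ := hA.nonempty
  exact ((hA.serre (hK.conflation_isIso_zero (𝟙 X) hZ)).1 hX).2

lemma prop_of_iso {X Y : C} (e : X ≅ Y) (hX : A X) : A Y :=
  have := hasZeroObject_of_hasFiniteBiproducts C
  (hA.serre (hK.conflation_isIso_zero e.hom (isZero_zero C))).2
    ⟨hX, hA.prop_of_isZero hK (isZero_zero C)⟩

lemma weakIsomorphisms_iff {X Y : C} {f : X ⟶ Y} : K.weakIsomorphisms A f ↔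
    ∃ φ : K.AdmissibleFactorization f, A φ.ker ∧ A φ.coker := by
  refine ⟨fun ⟨hf, ⟨N, k, w, ⟨hk⟩, hN⟩, ⟨L, c, w', ⟨hc⟩, hL⟩⟩ => ?_, fun ⟨φ, hker, hcoker⟩ => ?_⟩
  · obtain ⟨φ⟩ := hf.nonempty_factorization
    obtain ⟨hk'⟩ := hK.nonempty_isLimit_ker φ
    obtain ⟨hc'⟩ := hK.nonempty_isColimit_coker φ
    exact ⟨φ, hA.prop_of_iso hK (hk.conePointUniqueUpToIso hk') hN,
      hA.prop_of_iso hK (hc.coconePointUniqueUpToIso hc') hL⟩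
  · exact ⟨φ.admissible, ⟨φ.ker, φ.k, _, hK.nonempty_isLimit_ker φ, hker⟩,
      ⟨φ.coker, φ.c, _, hK.nonempty_isColimit_coker φ, hcoker⟩⟩

lemma weakIsomorphisms_of_deflation {N X Y : C} {k : N ⟶ X} {p : X ⟶ Y} (h : K.Conflation k p)
    (hN : A N) : K.weakIsomorphisms A p := by
  have := hasZeroObject_of_hasFiniteBiproducts C
  have hY := hK.conflation_isIso_zero (𝟙 Y) (isZero_zero C)
  exact (hA.weakIsomorphisms_iff hK).2 ⟨⟨k, p, 𝟙 Y, 0, h, hY, Category.comp_id p⟩, hN,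
    hA.prop_of_isZero hK (isZero_zero C)⟩

lemma weakIsomorphisms_of_inflation {X Y L : C} {i : X ⟶ Y} {c : Y ⟶ L} (h : K.Conflation i c)
    (hL : A L) : K.weakIsomorphisms A i := by
  have := hasZeroObject_of_hasFiniteBiproducts C
  have hX := hK.conflation_zero_isIso (𝟙 X) (isZero_zero C)
  exact (hA.weakIsomorphisms_iff hK).2 ⟨⟨0, 𝟙 X, i, c, hX, h, Category.id_comp i⟩,
    hA.prop_of_isZero hK (isZero_zero C), hL⟩

lemma op_weakIsomorphisms_iff {X Y : Cᵒᵖ} {f : X ⟶ Y} :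
    K.op.weakIsomorphisms A.op f ↔ K.weakIsomorphisms A f.unop := by
  rw [hA.op.weakIsomorphisms_iff hK.op, hA.weakIsomorphisms_iff hK]
  exact ⟨fun ⟨φ, hker, hcoker⟩ => ⟨φ.unop, hcoker, hker⟩,
    fun ⟨φ, hker, hcoker⟩ => ⟨φ.op, hcoker, hker⟩⟩

end IsSerreSubcategory

namespace IsDeflationPercolating

variable (hA : K.IsDeflationPercolating A) (hK : K.IsExactStructure)
include hA hK

lemma prop_of_mono {X T : C} (f : X ⟶ T) [Mono f] (hT : A T) : A X := by
  obtain ⟨φ, hI, -⟩ := hA.exists_factorization f hT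
  have := mono_of_mono_fac φ.fac
  have := hK.isIso_right_of_mono φ.conflation_ker
  exact hA.prop_of_iso hK (asIso φ.p).symm hI

lemma deflation_of_epi {X T : C} (f : X ⟶ T) [Epi f] (hT : A T) : K.Deflation f := by
  obtain ⟨φ, -, -⟩ := hA.exists_factorization f hT
  have := epi_of_epi_fac φ.fac
  have := hK.isIso_left_of_epi φ.conflation_coker
  rw [← φ.fac]
  exact hK.deflation_comp φ.conflation_ker.deflation (hK.deflation_of_isIso φ.i)

lemma exists_weakIsomorphism_comp_eq_zero {X T : C} (f : X ⟶ T) (hT : A T) :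
    ∃ (X' : C) (x : X' ⟶ X), K.weakIsomorphisms A x ∧ x ≫ f = 0 := by
  obtain ⟨φ, hI, -⟩ := hA.exists_factorization f hT
  exact ⟨φ.ker, φ.k, hA.weakIsomorphisms_of_inflation hK φ.conflation_ker hI, hK.ker_comp φ⟩

lemma prop_ker_of_weakIsomorphisms_comp {X Y Z : C} {f : X ⟶ Y} {g : Y ⟶ Z}
    (φ : K.AdmissibleFactorization f) (h : K.weakIsomorphisms A (f ≫ g)) : A φ.ker := by
  obtain ⟨ψ, hker, -⟩ := (hA.weakIsomorphisms_iff hK).1 h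
  have := hK.mono φ.conflation_ker
  obtain ⟨l, hl⟩ := hK.exists_lift_ker ψ φ.k (by rw [reassoc_of% hK.ker_comp φ, zero_comp])
  have := mono_of_mono_fac hl
  exact hA.prop_of_mono hK l hker

lemma exists_factorization_inflation_comp_deflation {X Y Z L N : C} {i : X ⟶ Y} {c : Y ⟶ L}
    {n : N ⟶ Y} {p : Y ⟶ Z} (hi : K.Conflation i c) (hp : K.Conflation n p) (hL : A L) :
    ∃ φ : K.AdmissibleFactorization (i ≫ p), A φ.coker ∧ (A N → A φ.ker) := by
  -- Dividing `Y` by the kernel of `n ≫ c` reduces to the case where `n ≫ c` is an inflation.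
  obtain ⟨ψ, -, hcoker⟩ := hA.exists_factorization (n ≫ c) hL
  have := hK.epi hi
  have := hK.epi ψ.conflation_ker
  have := hK.epi ψ.conflation_coker
  obtain ⟨V, v, hv⟩ := hK.inflation_comp ψ.conflation_ker.inflation hp.inflation
  have := hK.epi hv
  obtain ⟨n', p', hn', hp', hn'p'⟩ := hK.exists_conflation_coker_comp ψ.conflation_ker hp hv
  obtain ⟨c', hc'⟩ := hK.exists_desc hv c (by rw [Category.assoc, hK.ker_comp ψ])
  have := epi_of_epi_fac hc'
  obtain ⟨W, i', hi'⟩ := hA.deflation_of_epi hK c' hL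
  obtain ⟨k, d, -, hd, hkd⟩ := hK.exists_conflation_ker_comp hv hi' (hc' ▸ hi)
  have hn'c' : n' ≫ c' = ψ.i := by
    rw [← cancel_epi ψ.p, ← reassoc_of% hn', hc', ψ.fac]
  obtain ⟨z, hz⟩ := hK.exists_desc hp (c ≫ ψ.c) (by rw [← Category.assoc, hK.comp_coker ψ])
  have := epi_of_epi_fac hz
  have hp'z : p' ≫ z = c' ≫ ψ.c := by
    rw [← cancel_epi v, reassoc_of% hp', hz, reassoc_of% hc']
  have hi'p' : K.Conflation (i' ≫ p') z :=
    hK.conflation_comp_of_conflation_comp hi' hn'p' (hn'c'.symm ▸ ψ.conflation_coker)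
      (hA.deflation_of_epi hK z hcoker) hp'z
  have fac : d ≫ i' ≫ p' = i ≫ p := by rw [← reassoc_of% hd, hp']
  exact ⟨⟨k, d, _, z, hkd, hi'p', fac⟩, hcoker, fun hN => ((hA.serre ψ.conflation_ker).1 hN).1⟩

lemma weakIsomorphisms_comp {X Y Z : C} {s : X ⟶ Y} {t : Y ⟶ Z} (hs : K.weakIsomorphisms A s)
    (ht : K.weakIsomorphisms A t) : K.weakIsomorphisms A (s ≫ t) := by
  rw [hA.weakIsomorphisms_iff hK] at hs ht ⊢
  obtain ⟨φ, hφker, hφcoker⟩ := hs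
  obtain ⟨ψ, hψker, hψcoker⟩ := ht
  obtain ⟨χ, hχcoker, hχker⟩ := hA.exists_factorization_inflation_comp_deflation hK
    φ.conflation_coker ψ.conflation_ker hφcoker
  obtain ⟨ω, ⟨a, b, hab⟩, ⟨a', b', hab'⟩⟩ := hK.exists_factorization_comp φ ψ χ
  exact ⟨ω, (hA.serre hab).2 ⟨hφker, hχker hψker⟩, (hA.serre hab').2 ⟨hχcoker, hψcoker⟩⟩

lemma admissible_weakIsomorphism_comp {X Y Z : C} {s : X ⟶ Y} {f : Y ⟶ Z}
    (hs : K.weakIsomorphisms A s) (hf : K.Admissible f) : K.Admissible (s ≫ f) := by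
  obtain ⟨φ, -, hcoker⟩ := (hA.weakIsomorphisms_iff hK).1 hs
  obtain ⟨ψ⟩ := hf.nonempty_factorization
  obtain ⟨χ, -, -⟩ := hA.exists_factorization_inflation_comp_deflation hK
    φ.conflation_coker ψ.conflation_ker hcoker
  obtain ⟨ω, -, -⟩ := hK.exists_factorization_comp φ ψ χ
  exact ω.admissible

lemma weakIsomorphisms_of_isPullback {P X Y Z : C} {s' : P ⟶ X} {p' : P ⟶ Y} {p : X ⟶ Z}
    {s : Y ⟶ Z} (hP : IsPullback s' p' p s) (hp : K.Deflation p) (hs : K.weakIsomorphisms A s) :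
    K.weakIsomorphisms A s' := by
  obtain ⟨φ, hker, hcoker⟩ := (hA.weakIsomorphisms_iff hK).1 hs
  obtain ⟨X', x, hx⟩ := hK.deflation_comp hp φ.conflation_coker.deflation
  obtain ⟨r, hr⟩ := hK.exists_isPullback_of_conflation_comp φ.conflation_coker hx
  obtain ⟨d, hdx, hdr⟩ := hr.exists_lift s' (p' ≫ φ.p) (by rw [hP.w, Category.assoc, φ.fac])
  have hd : IsPullback p' d φ.p r :=
    IsPullback.of_bot (by rw [hdx, φ.fac]; exact hP.flip) hdr.symm hr.flip
  obtain ⟨k', -, hk'⟩ := hK.exists_conflation_of_isPullback hd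
    (hK.deflation_of_isPullback hd φ.conflation_ker.deflation) φ.conflation_ker
  rw [← hdx]
  exact hA.weakIsomorphisms_comp hK (hA.weakIsomorphisms_of_deflation hK hk' hker)
    (hA.weakIsomorphisms_of_inflation hK hx hcoker)

lemma hasRightCalculusOfFractions : (K.weakIsomorphisms A).HasRightCalculusOfFractions where
  id_mem X := by
    have := hasZeroObject_of_hasFiniteBiproducts C
    exact hA.weakIsomorphisms_of_deflation hK (hK.conflation_zero_isIso (𝟙 X) (isZero_zero C))
      (hA.prop_of_isZero hK (isZero_zero C))
  comp_mem _ _ hs ht := hA.weakIsomorphisms_comp hK hs ht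
  exists_rightFraction X Y α := by
    obtain ⟨φ, hker, hcoker⟩ := (hA.weakIsomorphisms_iff hK).1 α.hs
    obtain ⟨X', x, hx, hxc⟩ := hA.exists_weakIsomorphism_comp_eq_zero hK (α.f ≫ φ.c) hcoker
    obtain ⟨l, hl⟩ := hK.exists_lift φ.conflation_coker (x ≫ α.f) (by rw [Category.assoc, hxc])
    obtain ⟨P, g, d, k, hP, hk⟩ := hK.exists_baseChange φ.conflation_ker l
    have hd := hA.weakIsomorphisms_of_deflation hK hk hker
    exact ⟨⟨d ≫ x, hA.weakIsomorphisms_comp hK hd hx, g⟩,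
      by rw [Category.assoc, ← hl, ← reassoc_of% hP.w, φ.fac]⟩
  ext X Y Z f g s hs hfg := by
    obtain ⟨φ, hker, -⟩ := (hA.weakIsomorphisms_iff hK).1 hs
    obtain ⟨l, hl⟩ := hK.exists_lift_ker φ (f - g) (by rw [Preadditive.sub_comp, hfg, sub_self])
    obtain ⟨X', x, hx, hxl⟩ := hA.exists_weakIsomorphism_comp_eq_zero hK l hker
    refine ⟨X', x, hx, ?_⟩
    rw [← sub_eq_zero, ← Preadditive.comp_sub, ← hl, reassoc_of% hxl, zero_comp]

end IsDeflationPercolating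

namespace IsInflationPercolating

variable (hA : K.IsInflationPercolating A) (hK : K.IsExactStructure)
include hA hK

lemma inflation_of_mono {T X : C} (f : T ⟶ X) [Mono f] (hT : A T) : K.Inflation f :=
  op_deflation_iff.1 (hA.op.deflation_of_epi hK.op f.op hT)

lemma prop_coker_of_weakIsomorphisms_comp {X Y Z : C} {f : X ⟶ Y} {g : Y ⟶ Z}
    (φ : K.AdmissibleFactorization g) (h : K.weakIsomorphisms A (f ≫ g)) : A φ.coker :=
  hA.op.prop_ker_of_weakIsomorphisms_comp hK.op φ.op (g := f.op)
    ((hA.op_weakIsomorphisms_iff hK).2 h)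

lemma admissible_comp_weakIsomorphism {X Y Z : C} {f : X ⟶ Y} {s : Y ⟶ Z}
    (hf : K.Admissible f) (hs : K.weakIsomorphisms A s) : K.Admissible (f ≫ s) :=
  op_admissible_iff.1 (hA.op.admissible_weakIsomorphism_comp hK.op (s := s.op) (f := f.op)
    ((hA.op_weakIsomorphisms_iff hK).2 hs) (op_admissible_iff.2 hf))

lemma hasLeftCalculusOfFractions : (K.weakIsomorphisms A).HasLeftCalculusOfFractions := by
  have h := hA.op.hasRightCalculusOfFractions hK.op
  have op_eq : K.op.weakIsomorphisms A.op = (K.weakIsomorphisms A).op :=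
    MorphismProperty.ext _ _ fun _ _ _ => hA.op_weakIsomorphisms_iff hK
  rw [op_eq] at h
  exact inferInstanceAs ((K.weakIsomorphisms A).op.unop.HasLeftCalculusOfFractions)

lemma admissible_of_deflation_comp {N X Y Z : C} {k : N ⟶ X} {p : X ⟶ Y} {f : Y ⟶ Z}
    (hk : K.Conflation k p) (hN : A N) (hf : K.Admissible (p ≫ f)) : K.Admissible f := by
  obtain ⟨φ⟩ := hf.nonempty_factorization
  have := hK.mono hk
  have := hK.epi hk
  obtain ⟨a, rfl⟩ := hK.exists_lift_ker φ k
    (by rw [← Category.assoc, hK.comp_eq_zero hk, zero_comp])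
  have : Mono a := mono_of_mono a φ.k
  obtain ⟨_, e, he⟩ := hA.inflation_of_mono hK a hN
  obtain ⟨l, r, -, hpr, hlr⟩ := hK.exists_conflation_coker_comp he φ.conflation_ker hk
  exact ⟨φ.im, r, φ.i, hlr.deflation, φ.conflation_coker.inflation,
    by rw [← cancel_epi p, reassoc_of% hpr, φ.fac]⟩

lemma admissible_of_inflation_comp_inflation {X Y Z L : C} {i : X ⟶ Y} {c : Y ⟶ L} {f : Y ⟶ Z}
    (hi : K.Conflation i c) (hL : A L) (hf : K.Inflation (i ≫ f)) : K.Admissible f := by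
  obtain ⟨M, g, hg⟩ := hf
  obtain ⟨γ, hγ⟩ := hK.exists_desc hi (f ≫ g) (by rw [← Category.assoc, hK.comp_eq_zero hg])
  obtain ⟨ψ⟩ := (hA.admissible_of_prop_source γ hL).nonempty_factorization
  obtain ⟨W, y, hy⟩ := hK.deflation_comp hg.deflation ψ.conflation_coker.deflation
  have := hK.mono hy
  have := hK.mono ψ.conflation_coker
  obtain ⟨x, r, hxy, hyg, hx⟩ := hK.exists_conflation_ker_comp hg ψ.conflation_coker hy
  obtain ⟨f', hf'⟩ := hK.exists_lift hy f
    (by rw [← reassoc_of% hγ, hK.comp_coker ψ, comp_zero])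
  have hP : IsPullback c f' ψ.p r := hK.isPullback_of_conflations hi hx
    (by rw [← cancel_mono y, Category.assoc, hf', hxy])
    (by rw [← cancel_mono ψ.i, Category.assoc, ← hyg, reassoc_of% hf', Category.assoc, ψ.fac, hγ])
  exact ⟨W, f', y, hK.deflation_of_isPullback hP ψ.conflation_ker.deflation, hy.inflation, hf'⟩

lemma admissible_of_inflation_comp {X Y Z L : C} {i : X ⟶ Y} {c : Y ⟶ L} {f : Y ⟶ Z}
    (hi : K.Conflation i c) (hL : A L) (hf : K.Admissible (i ≫ f)) : K.Admissible f := by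
  obtain ⟨φ⟩ := hf.nonempty_factorization
  -- Dividing by the kernel of `i ≫ f` reduces to the case where `i ≫ f` is an inflation.
  obtain ⟨P, m, hm⟩ := hK.inflation_comp φ.conflation_ker.inflation hi.inflation
  obtain ⟨j, r, him, -, hj⟩ := hK.exists_conflation_coker_comp φ.conflation_ker hi hm
  obtain ⟨g, rfl⟩ := hK.exists_desc hm f (by rw [Category.assoc, hK.ker_comp φ])
  have := hK.epi φ.conflation_ker
  have hjg : j ≫ g = φ.i := by rw [← cancel_epi φ.p, ← reassoc_of% him, φ.fac]
  exact hK.admissible_deflation_comp hm.deflation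
    (hA.admissible_of_inflation_comp_inflation hK hj hL (hjg ▸ φ.conflation_coker.inflation))

lemma admissible_of_weakIsomorphism_comp {X Y Z : C} {s : X ⟶ Y} {f : Y ⟶ Z}
    (hs : K.weakIsomorphisms A s) (hf : K.Admissible (s ≫ f)) : K.Admissible f := by
  obtain ⟨φ, hker, hcoker⟩ := (hA.weakIsomorphisms_iff hK).1 hs
  rw [← φ.fac, Category.assoc] at hf
  exact hA.admissible_of_inflation_comp hK φ.conflation_coker hcoker
    (hA.admissible_of_deflation_comp hK φ.conflation_ker hker hf)

end IsInflationPercolating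

lemma IsDeflationPercolating.admissible_of_comp_weakIsomorphism (hA : K.IsDeflationPercolating A)
    (hK : K.IsExactStructure) {X Y Z : C} {f : X ⟶ Y} {s : Y ⟶ Z} (hs : K.weakIsomorphisms A s)
    (hf : K.Admissible (f ≫ s)) : K.Admissible f :=
  op_admissible_iff.1 (hA.op.admissible_of_weakIsomorphism_comp hK.op (s := s.op) (f := f.op)
    ((hA.op_weakIsomorphisms_iff hK).2 hs) (op_admissible_iff.2 hf))

namespace IsTwoSidedPercolating

variable (hA : K.IsTwoSidedPercolating A) (hK : K.IsExactStructure)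
include hA hK

lemma admissible_of_mono_of_weakIsomorphisms_comp {X Y Z : C} {f : X ⟶ Y} {g : Y ⟶ Z} [Mono g]
    (h : K.weakIsomorphisms A (f ≫ g)) : K.Admissible g := by
  obtain ⟨φ, -, hcoker⟩ := (hA.inflationPercolating.weakIsomorphisms_iff hK).1 h
  obtain ⟨ψ, him, -⟩ := hA.deflationPercolating.exists_factorization (g ≫ φ.c) hcoker
  have := hK.mono ψ.conflation_ker
  have := hK.mono φ.conflation_coker
  have := hK.strongEpi φ.conflation_ker
  obtain ⟨g', hg'⟩ := hK.exists_lift φ.conflation_coker (ψ.k ≫ g)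
    (by rw [Category.assoc, hK.ker_comp ψ])
  obtain ⟨f', hf'⟩ := hK.exists_lift_ker ψ f (by rw [← Category.assoc, hK.comp_coker φ])
  have hf'g' : f' ≫ g' = φ.p := by
    rw [← cancel_mono φ.i, Category.assoc, hg', reassoc_of% hf', φ.fac]
  have : Mono g' := mono_of_mono_fac hg'
  have : StrongEpi (f' ≫ g') := by rwa [hf'g']
  have := strongEpi_of_strongEpi f' g'
  have := isIso_of_mono_of_strongEpi g'
  refine hA.inflationPercolating.admissible_of_inflation_comp_inflation hK ψ.conflation_ker him ?_
  rw [← hg']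
  exact hK.inflation_comp (hK.inflation_of_isIso g') φ.conflation_coker.inflation

lemma admissible_of_weakIsomorphisms_comp {U X Y Z : C} {u : U ⟶ X} {f : X ⟶ Y} {v : Y ⟶ Z}
    (hu : K.weakIsomorphisms A (u ≫ f)) (hv : K.weakIsomorphisms A (f ≫ v)) :
    K.Admissible f := by
  obtain ⟨φ, hker, -⟩ := (hA.inflationPercolating.weakIsomorphisms_iff hK).1 hv
  obtain ⟨ψ⟩ := (hA.inflationPercolating.admissible_of_prop_source (φ.k ≫ f)
    hker).nonempty_factorization
  obtain ⟨I, q, hq⟩ :=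
    hK.inflation_comp ψ.conflation_ker.inflation φ.conflation_ker.inflation
  obtain ⟨g, rfl⟩ := hK.exists_desc hq f (by rw [Category.assoc, hK.ker_comp ψ])
  have : Mono g := hK.mono_of_exists_lift hq fun t ht => by
    obtain ⟨l, rfl⟩ := hK.exists_lift_ker φ t (by rw [← Category.assoc, ht, zero_comp])
    obtain ⟨l', rfl⟩ := hK.exists_lift_ker ψ l (by rw [← Category.assoc, ht])
    exact ⟨l', (Category.assoc _ _ _).symm⟩
  rw [← Category.assoc] at hu
  exact hK.admissible_deflation_comp hq.deflation
    (hA.admissible_of_mono_of_weakIsomorphisms_comp hK hu)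

lemma weakIsomorphisms_of_comp {U X Y Z : C} {u : U ⟶ X} {f : X ⟶ Y} {v : Y ⟶ Z}
    (hu : K.weakIsomorphisms A (u ≫ f)) (hv : K.weakIsomorphisms A (f ≫ v)) :
    K.weakIsomorphisms A f := by
  obtain ⟨φ⟩ := (hA.admissible_of_weakIsomorphisms_comp hK hu hv).nonempty_factorization
  exact (hA.inflationPercolating.weakIsomorphisms_iff hK).2
    ⟨φ, hA.deflationPercolating.prop_ker_of_weakIsomorphisms_comp hK φ hv,
      hA.inflationPercolating.prop_coker_of_weakIsomorphisms_comp hK φ hu⟩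

end IsTwoSidedPercolating

end Percolating

/-! ### The quotient category -/

section Image

variable {C : Type u} [Category.{v} C] {K : SequenceClass C} {D : Type u'} [Category.{v'} D]
  (F : C ⥤ D)

lemma Conflation.map {X Y Z : C} {f : X ⟶ Y} {g : Y ⟶ Z} (h : K.Conflation f g) :
    (K.image F).Conflation (F.map f) (F.map g) :=
  ⟨X, Y, Z, f, g, Iso.refl _, Iso.refl _, Iso.refl _, h, by simp, by simp⟩

lemma Admissible.map {X Y : C} {f : X ⟶ Y} (h : K.Admissible f) :
    (K.image F).Admissible (F.map f) := by
  obtain ⟨I, p, i, ⟨N, k, hk⟩, ⟨L, c, hc⟩, rfl⟩ := h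
  exact ⟨F.obj I, F.map p, F.map i, (hk.map F).deflation, (hc.map F).inflation,
    (F.map_comp p i).symm⟩

variable {F}

lemma exists_of_image_deflation {X Y : D} {p : X ⟶ Y} (hp : (K.image F).Deflation p) :
    ∃ (X' Y' : C) (p' : X' ⟶ Y') (b : F.obj X' ≅ X) (c : F.obj Y' ≅ Y),
      K.Deflation p' ∧ p = b.inv ≫ F.map p' ≫ c.hom := by
  obtain ⟨_, _, _, X', Y', _, p', _, b, c, h, -, w⟩ := hp
  exact ⟨X', Y', p', b, c, h.deflation, ((Iso.inv_comp_eq b).2 w).symm⟩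

lemma exists_of_image_inflation {X Y : D} {i : X ⟶ Y} (hi : (K.image F).Inflation i) :
    ∃ (X' Y' : C) (i' : X' ⟶ Y') (a : F.obj X' ≅ X) (b : F.obj Y' ≅ Y),
      K.Inflation i' ∧ i = a.inv ≫ F.map i' ≫ b.hom := by
  obtain ⟨_, _, X', Y', _, i', _, a, b, _, h, w, -⟩ := hi
  exact ⟨X', Y', i', a, b, h.inflation, ((Iso.inv_comp_eq a).2 w).symm⟩

end Image

section CalculusOfFractions

variable {C : Type u} [Category.{v} C] {D : Type u'} [Category.{v'} D] (Q : C ⥤ D)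
  (W : MorphismProperty C) [Q.IsLocalization W] {X Y : C} (f : X ⟶ Y) [IsIso (Q.map f)]
include Q

lemma exists_comp_mem_of_isIso_map [W.HasLeftCalculusOfFractions] :
    ∃ (Z : C) (g : Y ⟶ Z), W (f ≫ g) := by
  obtain ⟨φ, hφ⟩ := Localization.exists_leftFraction Q W (inv (Q.map f))
  have hfφ : Q.map (f ≫ φ.f) = Q.map φ.s := by
    rw [Q.map_comp, ← φ.map_comp_map_s Q (Localization.inverts Q W), ← hφ,
      IsIso.hom_inv_id_assoc]
  obtain ⟨Z, s, hs, hfs⟩ := (MorphismProperty.map_eq_iff_postcomp Q W _ _).1 hfφ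
  exact ⟨Z, φ.f ≫ s, by rw [← Category.assoc, hfs]; exact W.comp_mem _ _ φ.hs hs⟩

lemma exists_mem_comp_of_isIso_map [W.HasRightCalculusOfFractions] :
    ∃ (Z : C) (g : Z ⟶ X), W (g ≫ f) := by
  have : IsIso (Q.op.map f.op) := inferInstanceAs (IsIso (Q.map f).op)
  obtain ⟨Z, g, hg⟩ := exists_comp_mem_of_isIso_map Q.op W.op f.op
  exact ⟨Z.unop, g.unop, hg⟩

end CalculusOfFractions

section Localization

variable {E : Type u} [Category.{v} E] [Preadditive E] [HasFiniteBiproducts E]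
  {K : SequenceClass E} {A : ObjectProperty E} {D : Type u'} [Category.{v'} D]
  (Q : E ⥤ D) [Q.IsLocalization (K.weakIsomorphisms A)]

namespace IsTwoSidedPercolating

variable (hA : K.IsTwoSidedPercolating A) (hK : K.IsExactStructure)
include hA hK

lemma weakIsomorphisms_of_isIso_map {X Y : E} (f : X ⟶ Y) [IsIso (Q.map f)] :
    K.weakIsomorphisms A f := by
  have := hA.deflationPercolating.hasRightCalculusOfFractions hK
  have := hA.inflationPercolating.hasLeftCalculusOfFractions hK
  obtain ⟨_, _, hu⟩ := exists_mem_comp_of_isIso_map Q (K.weakIsomorphisms A) f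
  obtain ⟨_, _, hv⟩ := exists_comp_mem_of_isIso_map Q (K.weakIsomorphisms A) f
  exact hA.weakIsomorphisms_of_comp hK hu hv

lemma exists_rightRoof {X Y : E} (α : Q.obj X ≅ Q.obj Y) :
    ∃ (W : E) (s : W ⟶ X) (t : W ⟶ Y), K.weakIsomorphisms A s ∧ K.weakIsomorphisms A t ∧
      Q.map s ≫ α.hom = Q.map t := by
  have := hA.deflationPercolating.hasRightCalculusOfFractions hK
  have hQ := Localization.inverts Q (K.weakIsomorphisms A)
  obtain ⟨φ, hφ⟩ := Localization.exists_rightFraction Q (K.weakIsomorphisms A) α.hom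
  have h : Q.map φ.s ≫ α.hom = Q.map φ.f := by rw [hφ, φ.map_s_comp_map Q hQ]
  have := hQ φ.s φ.hs
  have : IsIso (Q.map φ.f) := by rw [← h]; infer_instance
  exact ⟨_, φ.s, φ.f, φ.hs, hA.weakIsomorphisms_of_isIso_map Q hK φ.f, h⟩

lemma exists_leftRoof {X Y : E} (α : Q.obj X ≅ Q.obj Y) :
    ∃ (W : E) (s : X ⟶ W) (t : Y ⟶ W), K.weakIsomorphisms A s ∧ K.weakIsomorphisms A t ∧
      α.hom ≫ Q.map t = Q.map s := by
  have := hA.inflationPercolating.hasLeftCalculusOfFractions hK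
  have hQ := Localization.inverts Q (K.weakIsomorphisms A)
  obtain ⟨φ, hφ⟩ := Localization.exists_leftFraction Q (K.weakIsomorphisms A) α.hom
  have h : α.hom ≫ Q.map φ.s = Q.map φ.f := by rw [hφ, φ.map_comp_map_s Q hQ]
  have := hQ φ.s φ.hs
  have : IsIso (Q.map φ.f) := by rw [← h]; infer_instance
  exact ⟨_, φ.f, φ.s, hA.weakIsomorphisms_of_isIso_map Q hK φ.f, φ.hs, h⟩

lemma admissible_of_iso {X Y X' Y' : E} {f : X ⟶ Y} {g : X' ⟶ Y'} (hg : K.Admissible g)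
    (α : Q.obj X ≅ Q.obj X') (β : Q.obj Y' ≅ Q.obj Y)
    (h : Q.map f = α.hom ≫ Q.map g ≫ β.hom) : K.Admissible f := by
  have ⟨hdefl, hinfl⟩ := hA
  have := hdefl.hasRightCalculusOfFractions hK
  obtain ⟨W, a, b, ha, hb, hab⟩ := hA.exists_rightRoof Q hK α
  obtain ⟨V, d, c, hd, hc, hdc⟩ := hA.exists_leftRoof Q hK β
  have hQ : Q.map (a ≫ f ≫ c) = Q.map (b ≫ g ≫ d) := by
    simp only [Q.map_comp, h, Category.assoc, hdc, reassoc_of% hab]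
  obtain ⟨Z, e, he, hfg⟩ :=
    (MorphismProperty.map_eq_iff_precomp Q (K.weakIsomorphisms A) _ _).1 hQ
  have hgd : K.Admissible (e ≫ b ≫ g ≫ d) :=
    hdefl.admissible_weakIsomorphism_comp hK he (hdefl.admissible_weakIsomorphism_comp hK hb
      (hinfl.admissible_comp_weakIsomorphism hK hg hd))
  rw [← hfg] at hgd
  exact hdefl.admissible_of_comp_weakIsomorphism hK hc
    (hinfl.admissible_of_weakIsomorphism_comp hK ha
      (hinfl.admissible_of_weakIsomorphism_comp hK he hgd))

lemma admissible_of_admissible_map {X Y : E} {f : X ⟶ Y}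
    (hf : (K.image Q).Admissible (Q.map f)) : K.Admissible f := by
  have ⟨hdefl, _⟩ := hA
  obtain ⟨I, _, _, hp', hi', hf⟩ := hf
  obtain ⟨X₁, I₁, p, b, c, hp, rfl⟩ := exists_of_image_deflation hp'
  obtain ⟨I₂, Y₂, i, a, d, hi, rfl⟩ := exists_of_image_inflation hi'
  obtain ⟨J, s, t, hs, ht, hst⟩ := hA.exists_rightRoof Q hK (c ≪≫ a.symm)
  have := hK.hasPullback p s hp
  have hP := IsPullback.of_hasPullback p s
  set s' := pullback.fst p s
  set q := pullback.snd p s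
  have hs' := hdefl.weakIsomorphisms_of_isPullback hK hP hp hs
  have := Localization.inverts Q (K.weakIsomorphisms A) s' hs'
  have hg : K.Admissible (q ≫ t ≫ i) :=
    hK.admissible_deflation_comp (hK.deflation_of_isPullback hP hp)
      (hdefl.admissible_weakIsomorphism_comp hK ht (hK.admissible_of_inflation hi))
  have hsq : Q.map p = inv (Q.map s') ≫ Q.map q ≫ Q.map s := by
    rw [← Q.map_comp, ← hP.w, Q.map_comp, IsIso.inv_hom_id_assoc]
  refine hA.admissible_of_iso Q hK hg (b.symm ≪≫ (asIso (Q.map s')).symm) d ?_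
  simp only [Iso.trans_hom, Iso.symm_hom] at hst
  simp only [← hf, hsq, Q.map_comp, ← hst, Iso.trans_hom, Iso.symm_hom, asIso_inv, Category.assoc]

end IsTwoSidedPercolating

end Localization

end SequenceClass

end PercolatingQuotient

/-- `K` is an exact structure on the additive category `E`, `A` is a two-sided admissibly
percolating subcategory, and `Q : E ⥤ D` is a localization of `E` at the weak
`A`-isomorphisms, i.e. the quotient functor onto `D = E / A`; the conflations of the quotient
are the sequences isomorphic to the images of conflations of `E`. -/
theorem mainTheorem7 {E : Type u} [Category.{v} E] [Preadditive E]
    [HasFiniteBiproducts E]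
    (K : PercolatingQuotient.SequenceClass E) (hK : K.IsExactStructure)
    (A : ObjectProperty E) (hA : K.IsTwoSidedPercolating A)
    {D : Type u'} [Category.{v'} D] (Q : E ⥤ D) [Q.IsLocalization (K.weakIsomorphisms A)]
    {X Y : E} (f : X ⟶ Y) :
    K.Admissible f ↔ (K.image Q).Admissible (Q.map f) :=
  ⟨fun h => h.map Q, hA.admissible_of_admissible_map Q hK⟩
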